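/- **Setting.** A (sub-stochastic) MDP $\mathcal M=(S,\mathrm{Act},P,\iota)$ has a finite set $S$ of states, a finite nonempty set $\mathrm{Act}(s)$ of actions for each state $s$, transition probabilities $P(s,\alpha,t)\ge 0$ with $\sum_t P(s,\alpha,t)\le 1$ for $\alpha\in\mathrm{Act}(s)$, and an initial subdistribution $\iota$ with $\sum_s\iota(s)\le 1$. Missing probability mass means failure. $\mathcal M(q)$ is $\mathcal M$ started in state $q$ with probability $1$. A scheduler chooses an enabled action after every finite path; $\mathbf{Pr}^{\max}(\lozenge G)$ and $\mathbf{Pr}^{\min}(\lozenge G)$ are the supremum and infimum over all schedulers of the probability that a path visits $G$. The underlying graph has an edge $s\to t$ iff $P(s,\alpha,t)>0$ for some $\alpha\in\mathrm{Act}(s)$. Let $\operatorname{Goal}\subseteq S$ be a set of trap states (states $g$ with $\sum_tP(g,\alpha,t)=0$ for all $\alpha\in\mathrm{Act}(g)$). Let $\mathcal P=\{B_1,\dots,B_n\}$ be a directed tree partition of $\mathcal M$: a partition of $S$ into nonempty blocks whose quotient graph, with edges inside a block ignored, is a directed tree (no pair of opposite edges, the underlying undirected graph is a tree, every in-degree is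 at most $1$). Assume that each block is contained in or disjoint from $\operatorname{Goal}$, and that all initial states ($\iota(s)>0$) lie in the root block. For a block $B$, let $\operatorname{inc}(B)$ be the set of states of $B$ that are initial or have an incoming edge from the parent block of $B$, let $\operatorname{out}(B)$ be the union of $\operatorname{inc}(C)$ over the children $C$ of $B$, and let $\operatorname{cl}(B)$ be the union of the blocks reachable from $B$ in the tree order (including $B$). For $T\subseteq S$ let $\mathcal M_T$ be the subsystem with state set $T$ that keeps exactly the transitions inside $T$. For $q\in T$ put $\operatorname{max-val}_T(q)=\mathbf{Pr}^{\max}_{\mathcal M_T(q)}(\lozenge\operatorname{Goal})$ and $\operatorname{min-val}_T(q)=\mathbf{Pr}^{\min}_{\mathcal M_T(q)}(\lozenge\operatorname{Goal})$; for $q\in S\setminus T$ both values are $0$. For a partial function $f$ from $S$ to $[0,1]$, the MDP $\mathcal M_T^f$ arises from $\mathcal M_T$ by removing all outgoing edges of the states $s\in T\cap\operatorname{dom}(f)$ and giving each of them instead a single action with a single transition, of probability $f(s)$, to an added goal state. $\operatorname{max-val}_T^f(q)$ and $\operatorname{min-val}_T^f(q)$ are the maximal and minimal probabilities of reaching a goal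 state in $\mathcal M_T^f(q)$, where the goal states are the added one and the states of $(T\cap\operatorname{Goal})\setminus\operatorname{dom}(f)$; thus a state of $\operatorname{dom}(f)$ reaches the goal only through its new edge. **Lemma.** Let $S'\subseteq S$, $1\le i\le n$, $S_2=S'\cap(\operatorname{cl}(B_i)\setminus B_i)$, $S_1=S'\setminus S_2$ and $S_1'=S_1\cup\operatorname{out}(B_i)$. Let $v\in\{\operatorname{max-val},\operatorname{min-val}\}$ and define $f$ with domain $\operatorname{out}(B_i)$ by $f(q)=v_{S_2}(q)$. Then for all $q\in S_1'$: \[ v_{S'}(q)=v_{S_1'}^{f}(q). \] Moreover, if $\operatorname{Goal}\cap\operatorname{out}(B_i)\subseteq S'$, the same equality holds when all states of $T\cap\operatorname{Goal}$ (also those in $\operatorname{dom}(f)$) count as goal states in the definition of $v_T^f$. -/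

import Mathlib

open MeasureTheory ProbabilityTheory
open scoped ENNReal

universe u v

/-! ### Discrete-time Markov chains and their path measure -/

/-- A (sub-stochastic, possibly infinite) discrete-time Markov chain with state set `X`. -/
structure DTMC (X : Type u) where
  P : X → X → ℝ≥0∞
  sum_P_le_one : ∀ x, ∑' y, P x y ≤ 1
  init : X → ℝ≥0∞
  sum_init_le_one : ∑' x, init x ≤ 1

/-- The states of a chain together with an extra state `none` ("fail"), which collects the missing
probability mass; it carries the discrete σ-algebra. -/
def WithFail (X : Type u) : Type u := Option X

instance (X : Type u) : MeasurableSpace (WithFail X) := ⊤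

/-- The completion of a subdistribution `p` on `X` to a distribution on `WithFail X`. -/
noncomputable def completePMF {X : Type u} (p : X → ℝ≥0∞) (hp : ∑' x, p x ≤ 1) :
    PMF (WithFail X) :=
  ⟨fun o : Option X => o.elim (1 - ∑' x, p x) p, by
    have h : ∑' o : Option X, (o.elim (1 - ∑' x, p x) p : ℝ≥0∞) = 1 := by
      rw [← (Equiv.optionEquivSumPUnit.{0} X).symm.tsum_eq,
        Summable.tsum_sum ENNReal.summable ENNReal.summable]
      simpa using add_tsub_cancel_of_le hp
    have h3 := (ENNReal.summable (f := fun o : Option X => o.elim (1 - ∑' x, p x) p)).hasSum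
    rwa [h] at h3⟩

namespace DTMC

variable {X : Type u} (C : DTMC X)

/-- One step of the completed chain; the fail state is absorbing. -/
noncomputable def step : WithFail X → PMF (WithFail X)
  | none => PMF.pure none
  | some x => completePMF (C.P x) (C.sum_P_le_one x)

noncomputable def stepKernel : Kernel (WithFail X) (WithFail X) where
  toFun x := (C.step x).toMeasure
  measurable' := measurable_from_top

instance : IsMarkovKernel C.stepKernel :=
  ⟨fun x => inferInstanceAs (IsProbabilityMeasure (C.step x).toMeasure)⟩

/-- The transition kernel at time `n`, which depends on a history only through its last state. -/
noncomputable def histKernel (n : ℕ) :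
    Kernel ((i : Finset.Iic n) → (fun _ : ℕ => WithFail X) i) (WithFail X) :=
  C.stepKernel.comap (fun h => h ⟨n, Finset.mem_Iic.2 le_rfl⟩) (measurable_pi_apply _)

instance (n : ℕ) : IsMarkovKernel (C.histKernel n) := by
  unfold histKernel; infer_instance

/-- The probability measure on trajectories. A maximal finite path, and the missing probability of
a sub-stochastic state, is represented by trajectories that move on to the fail state. -/
noncomputable def pathMeasure : Measure (ℕ → WithFail X) :=
  Kernel.trajMeasure (X := fun _ => WithFail X)
    (completePMF C.init C.sum_init_le_one).toMeasure C.histKernel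

/-- The event `◇ G` that some state of `G` is visited. -/
def eventually (G : Set X) : Set (ℕ → WithFail X) :=
  {ω | ∃ n, ∃ x ∈ G, ω n = some x}

end DTMC

/-! ### Markov decision processes -/

/-- A (sub-stochastic) Markov decision process with states `S` and actions from `A`. -/
structure MDP (S : Type u) (A : Type v) where
  Act : S → Finset A
  act_nonempty : ∀ s, (Act s).Nonempty
  P : S → A → S → ℝ≥0∞
  sum_P_le_one : ∀ s, ∀ α ∈ Act s, ∑' t, P s α t ≤ 1
  init : S → ℝ≥0∞
  sum_init_le_one : ∑' s, init s ≤ 1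

/-- The two kinds of optimization over schedulers. -/
inductive Extremum
  | max
  | min

namespace MDP

variable {S : Type u} {A : Type v} (M : MDP S A)

/-- A scheduler chooses an enabled action after every finite path `s₀ α₀ s₁ α₁ … sₙ`, given as the
list `[(s₀, α₀), …, (sₙ₋₁, αₙ₋₁)]` together with the last state `sₙ`. -/
structure Scheduler where
  choose : List (S × A) → S → A
  choose_mem : ∀ h s, choose h s ∈ M.Act s

open Classical in
/-- The Markov chain induced by a scheduler: its states are the finite paths. -/
noncomputable def induced (σ : M.Scheduler) : DTMC (List (S × A) × S) where
  P p q := if q.1 = p.1 ++ [(p.2, σ.choose p.1 p.2)] then M.P p.2 (σ.choose p.1 p.2) q.2 else 0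
  sum_P_le_one p := by
    rw [ENNReal.tsum_prod (f := fun h s => if h = p.1 ++ [(p.2, σ.choose p.1 p.2)] then
      M.P p.2 (σ.choose p.1 p.2) s else 0), ENNReal.tsum_comm]
    simp only [tsum_ite_eq]
    exact M.sum_P_le_one _ _ (σ.choose_mem _ _)
  init p := if p.1 = [] then M.init p.2 else 0
  sum_init_le_one := by
    rw [ENNReal.tsum_prod (f := fun h s => if h = [] then M.init s else 0), ENNReal.tsum_comm]
    simp only [tsum_ite_eq]
    exact M.sum_init_le_one

/-- The probability of `◇ G` under the scheduler `σ`. -/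
noncomputable def reachProb (G : Set S) (σ : M.Scheduler) : ℝ≥0∞ :=
  (M.induced σ).pathMeasure (DTMC.eventually {p | p.2 ∈ G})

/-- `Pr^max(◇ G)`, respectively `Pr^min(◇ G)`. -/
noncomputable def optProb (v : Extremum) (G : Set S) : ℝ≥0∞ :=
  match v with
  | .max => ⨆ σ : M.Scheduler, M.reachProb G σ
  | .min => ⨅ σ : M.Scheduler, M.reachProb G σ

open Classical in
/-- `M(q)`: the initial distribution is replaced by the Dirac distribution at `q`. -/
noncomputable def startAt (q : S) : MDP S A where
  Act := M.Act
  act_nonempty := M.act_nonempty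
  P := M.P
  sum_P_le_one := M.sum_P_le_one
  init s := if s = q then 1 else 0
  sum_init_le_one := by rw [tsum_ite_eq]

/-- The underlying graph. -/
def Edge (s t : S) : Prop := ∃ α ∈ M.Act s, 0 < M.P s α t

/-- Trap states: no action has an outgoing transition. -/
def IsTrap (s : S) : Prop := ∀ α ∈ M.Act s, ∑' t, M.P s α t = 0

/-- The subsystem `M_T` induced by a set of states `T`. -/
def induce (T : Set S) : MDP T A where
  Act s := M.Act s
  act_nonempty s := M.act_nonempty s
  P s α t := M.P s α t
  sum_P_le_one s α hα :=
    (ENNReal.tsum_comp_le_tsum_of_injective Subtype.val_injective _).trans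
      (M.sum_P_le_one s α hα)
  init s := M.init s
  sum_init_le_one :=
    (ENNReal.tsum_comp_le_tsum_of_injective Subtype.val_injective _).trans M.sum_init_le_one

open Classical in
/-- The MDP `M_T^f`, where `f` is a partial function with domain `D` and values in `[0,1]`: in the
subsystem induced by `T` all outgoing edges of states in `D` are replaced by a single action
(called `none`) with a single transition, of probability `f s`, to a goal state `Sum.inr ()`. -/
noncomputable def cut (T D : Set S) (f : S → ℝ≥0∞) (hf : ∀ s ∈ D, f s ≤ 1) :
    MDP (T ⊕ Unit) (Option A) where
  Act
    | .inl s => if (s : S) ∈ D then {none} else (M.Act s).map Function.Embedding.some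
    | .inr _ => {none}
  act_nonempty
    | .inl s => by
        by_cases hs : (s : S) ∈ D
        · simp [hs]
        · simpa [hs] using M.act_nonempty s
    | .inr _ => by simp
  P
    | .inl s, some α, .inl t => if (s : S) ∈ D then 0 else M.P s α t
    | .inl s, none, .inr _ => if (s : S) ∈ D then f s else 0
    | _, _, _ => 0
  sum_P_le_one
    | .inl s, α, hα => by
        rw [Summable.tsum_sum ENNReal.summable ENNReal.summable]
        by_cases hs : (s : S) ∈ D
        · simp only [hs, if_true, Finset.mem_singleton] at hα
          subst hα
          simpa [hs] using hf s hs
        · simp only [hs, if_false, Finset.mem_map] at hα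
          obtain ⟨α, hα, rfl⟩ := hα
          simpa [hs, induce] using (M.induce T).sum_P_le_one s α hα
    | .inr _, α, _ => by simp
  init
    | .inl s => M.init s
    | .inr _ => 0
  sum_init_le_one := by
    rw [Summable.tsum_sum ENNReal.summable ENNReal.summable]
    simpa [induce] using (M.induce T).sum_init_le_one

open Classical in
/-- `max-val_T(q)`, respectively `min-val_T(q)`, for the set `G` of goal states; states outside the
subsystem have value `0`. -/
noncomputable def val (v : Extremum) (G T : Set S) (q : S) : ℝ≥0∞ :=
  if h : q ∈ T then ((M.induce T).startAt ⟨q, h⟩).optProb v {t | (t : S) ∈ G} else 0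

/-- `max-val_T^f(q)`, respectively `min-val_T^f(q)`, for the set `G` of goal states. -/
noncomputable def cutVal (v : Extremum) (G T D : Set S) (f : S → ℝ≥0∞) (hf : ∀ s ∈ D, f s ≤ 1)
    (q : T) : ℝ≥0∞ :=
  ((M.cut T D f hf).startAt (.inl q)).optProb v
    (insert (.inr ()) (Sum.inl '' {t : T | (t : S) ∈ G}))

theorem reachProb_le_one (G : Set S) (σ : M.Scheduler) : M.reachProb G σ ≤ 1 := by
  unfold reachProb DTMC.pathMeasure
  exact prob_le_one

theorem optProb_le_one (v : Extremum) (G : Set S) : M.optProb v G ≤ 1 := by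
  cases v with
  | max => exact iSup_le fun σ => M.reachProb_le_one G σ
  | min =>
    exact (iInf_le _ ⟨fun _ s => (M.act_nonempty s).choose,
      fun _ s => (M.act_nonempty s).choose_spec⟩).trans (M.reachProb_le_one G _)

theorem val_le_one (v : Extremum) (G T : Set S) (q : S) : M.val v G T q ≤ 1 := by
  unfold val
  split_ifs
  · exact optProb_le_one _ _ _
  · exact zero_le_one

end MDP

/-! ### Directed tree partitions -/

/-- A directed graph, given by a relation, is a directed tree: it has no loops and no pairs of
opposite edges, its underlying undirected graph is a tree, and every in-degree is at most one. -/
structure IsDirectedTree {V : Type u} (E : V → V → Prop) : Prop where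
  asymm : ∀ x y, E x y → ¬ E y x
  isTree : (SimpleGraph.fromRel E).IsTree
  indegree_le_one : ∀ x y z, E x z → E y z → x = y

/-- The edges between distinct blocks in the quotient graph of `E` under a partition. -/
def QuotEdge {V : Type u} (E : V → V → Prop) (B C : Set V) : Prop :=
  B ≠ C ∧ ∃ s ∈ B, ∃ t ∈ C, E s t

/-- `Ps` is a directed tree partition of the graph `E`. Edges inside a block are ignored. -/
structure IsDirectedTreePartition {V : Type u} (E : V → V → Prop) (Ps : Set (Set V)) : Prop where
  isPartition : Setoid.IsPartition Ps
  isDirectedTree : IsDirectedTree fun B C : Ps => QuotEdge E B C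

namespace MDP

variable {S : Type u} {A : Type v} (M : MDP S A) (Ps : Set (Set S))

/-- `parent(B)` has an edge to `B` in the quotient (relational form: `C` is the parent of `B`);
equivalently `B` is a child of `C`. -/
def IsParent (C B : Set S) : Prop := C ∈ Ps ∧ B ∈ Ps ∧ QuotEdge M.Edge C B

/-- The states of `B` that are initial or have an incoming edge from a state in `parent(B)`. -/
def inc (B : Set S) : Set S :=
  {t ∈ B | (∃ C, M.IsParent Ps C B ∧ ∃ s ∈ C, M.Edge s t) ∨ 0 < M.init t}

/-- The union of `inc(C)` over the children `C` of `B`. -/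
def out (B : Set S) : Set S := ⋃ C ∈ {C | M.IsParent Ps B C}, M.inc Ps C

/-- The union of the blocks reachable from `B` in the tree order (including `B` itself). -/
def cl (B : Set S) : Set S := ⋃ C ∈ {C | Relation.ReflTransGen (M.IsParent Ps) B C}, C

/-- All initial states lie in the root block, the block without a parent. -/
def InitInRoot : Prop :=
  ∀ B ∈ Ps, ∀ s ∈ B, 0 < M.init s → ∀ C, ¬ M.IsParent Ps C B

end MDP

/-! Each action set is finite, so the optimal reachability probability is the least fixed point of
the Bellman operator, for the maximum and the minimum alike, and value iteration from `0` converges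
to it (`optProb_startAt`, `bellman_value`, `value_le_of_bellman_le`). Any function that the operator
does not increase is therefore an upper bound for the value, and the theorem becomes two comparisons
of this kind, carried out in `val_eq_cutVal`.

The tree enters only through two facts. No edge leaves `cl(B) \ B` (`cl_sdiff_closed`), so inside
`S'` the part `S₂` evolves on its own. Every edge entering `cl(B) \ B` ends in `out(B)`
(`mem_out_of_edge`), so the rest sees `S₂` only through the values that `f` records. Gluing the cut
value with the value of `S₂` bounds the value of `S'` from above. Conversely, the value of `S'`
bounds the cut value, because it dominates the value of `S₂`. -/

/-! ### Reachability in a Markov chain as a limit of bounded-step probabilities -/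

namespace DTMC

variable {X : Type u} (C : DTMC X)

/-- A function on `X`, extended by `0` to the fail state. -/
def failExtend (r : X → ℝ≥0∞) (o : WithFail X) : ℝ≥0∞ :=
  Option.elim (α := X) o 0 r

theorem measurable_of_withFail {β : Type*} [MeasurableSpace β] (f : WithFail X → β) :
    Measurable f :=
  measurable_from_top

theorem lintegral_toMeasure {Y : Type*} (p : PMF (WithFail Y)) (f : WithFail Y → ℝ≥0∞) :
    ∫⁻ y, f y ∂p.toMeasure = ∑' y, p y * f y := by
  have h : p.toMeasure = Measure.sum fun a => p a • Measure.dirac a := by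
    ext s hs
    rw [PMF.toMeasure_apply _ hs, Measure.sum_apply _ hs]
    refine tsum_congr fun a => ?_
    by_cases ha : a ∈ s <;> simp [Measure.dirac_apply' a hs, ha]
  rw [h, lintegral_sum_measure]
  refine tsum_congr fun a => ?_
  rw [lintegral_smul_measure, lintegral_dirac' _ (measurable_of_withFail f), smul_eq_mul]

theorem lintegral_completePMF (p : X → ℝ≥0∞) (hp : ∑' x, p x ≤ 1) (r : X → ℝ≥0∞) :
    ∫⁻ o, failExtend r o ∂(completePMF p hp).toMeasure = ∑' x, p x * r x := by
  rw [lintegral_toMeasure]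
  change ∑' o : Option X, (o.elim (1 - ∑' x, p x) p : ℝ≥0∞) * (o.elim 0 r : ℝ≥0∞) = _
  rw [← (Equiv.optionEquivSumPUnit.{0} X).symm.tsum_eq,
    Summable.tsum_sum ENNReal.summable ENNReal.summable]
  simp

open Classical in
/-- The probability of visiting `G` in fewer than `n` steps from a given state. -/
noncomputable def hitProb (G : Set X) : ℕ → X → ℝ≥0∞
  | 0, _ => 0
  | n + 1, x => if x ∈ G then 1 else ∑' y, C.P x y * hitProb G n y

theorem lintegral_step (r : X → ℝ≥0∞) (o : WithFail X) :
    ∫⁻ y, failExtend r y ∂(C.step o).toMeasure =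
      failExtend (fun x => ∑' y, C.P x y * r y) o := by
  cases o with
  | none =>
    rw [lintegral_toMeasure]
    change ∑' y : Option X, (PMF.pure (none : Option X)) y * failExtend r y = 0
    refine ENNReal.tsum_eq_zero.2 fun y => ?_
    cases y with
    | none => exact mul_zero _
    | some y =>
      have : (PMF.pure (none : Option X)) (some y) = 0 := by simp
      exact mul_eq_zero_of_left this _
  | some x => exact lintegral_completePMF _ (C.sum_P_le_one x) _

theorem lintegral_pathMeasure_zero (f : WithFail X → ℝ≥0∞) :
    ∫⁻ ω, f (ω 0) ∂C.pathMeasure =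
      ∫⁻ o, f o ∂(completePMF C.init C.sum_init_le_one).toMeasure := by
  have h : C.pathMeasure.map (fun ω => ω 0) =
      (completePMF C.init C.sum_init_le_one).toMeasure := by
    have hf : (fun ω : ℕ → WithFail X => ω 0) =
        (fun h : (i : Finset.Iic 0) → (fun _ : ℕ => WithFail X) i => h ⟨0, by simp⟩) ∘
          Preorder.frestrictLe 0 := rfl
    rw [hf, ← Measure.map_map (measurable_pi_apply _) (by fun_prop), pathMeasure,
      Kernel.trajMeasure, Measure.map_comp _ _ (by fun_prop),
      Kernel.traj_map_frestrictLe_of_le le_rfl, Measure.deterministic_comp_eq_map]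
    have h1 : Measurable fun h : (i : Finset.Iic 0) → (fun _ : ℕ => WithFail X) i =>
        h ⟨0, by simp⟩ := measurable_pi_apply _
    have h2 := Preorder.measurable_frestrictLe₂ (X := fun _ : ℕ => WithFail X) (le_refl 0)
    refine (Measure.map_map h1 h2).trans ?_
    refine (Measure.map_map (h1.comp h2) (MeasurableEquiv.measurable _)).trans ?_
    exact Measure.map_id
  rw [← h, lintegral_map (measurable_of_withFail f) (measurable_pi_apply 0)]

/-- This is the Markov property: given the first `m + 1` coordinates, the next one is distributed
according to `step` at the last of them. -/
theorem lintegral_pathMeasure_succ (m : ℕ)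
    (g : ((i : Finset.Iic m) → (fun _ : ℕ => WithFail X) i) × WithFail X → ℝ≥0∞)
    (hg : Measurable g) :
    ∫⁻ ω, g (Preorder.frestrictLe m ω, ω (m + 1)) ∂C.pathMeasure =
      ∫⁻ ω, ∫⁻ y, g (Preorder.frestrictLe m ω, y) ∂(C.step (ω m)).toMeasure ∂C.pathMeasure := by
  have h := Kernel.map_frestrictLe_trajMeasure_compProd_eq_map_trajMeasure
    (X := fun _ => WithFail X) (μ₀ := (completePMF C.init C.sum_init_le_one).toMeasure)
    (κ := C.histKernel) (a := m)
  have hm : Measurable fun ω : ℕ → WithFail X => (Preorder.frestrictLe m ω, ω (m + 1)) := by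
    fun_prop
  rw [← lintegral_map hg hm, pathMeasure, ← h, Measure.lintegral_compProd hg,
    lintegral_map (Measurable.lintegral_kernel_prod_right' hg) (by fun_prop)]
  rfl

/-- The states of `G` in the completed chain. -/
def embed (G : Set X) : Set (WithFail X) := {o | ∃ x ∈ G, o = some x}

/-- The event that `G` is visited before time `n`. -/
def hitBefore (G : Set X) (n : ℕ) : Set (ℕ → WithFail X) :=
  {ω | ∃ k < n, ω k ∈ embed G}

theorem measurableSet_hitBefore (G : Set X) (n : ℕ) : MeasurableSet (hitBefore G n) := by
  have : hitBefore G n = ⋃ k ∈ Set.Iio n, (fun ω => ω k) ⁻¹' embed G := by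
    ext; simp [hitBefore]
  rw [this]
  exact MeasurableSet.biUnion (Set.to_countable _) fun k _ =>
    measurable_pi_apply k (MeasurableSpace.measurableSet_top)

open Classical in
-- Averaging out the last coordinate by the Markov property replaces `r` by its one-step
-- expectation. A first visit at time exactly `m` moves from the event into the integrand.
theorem lintegral_hitBefore_succ (G : Set X) (m : ℕ) (r : X → ℝ≥0∞) :
    ∫⁻ ω, (if ω ∈ hitBefore G (m + 1) then 1 else failExtend r (ω (m + 1))) ∂C.pathMeasure =
      ∫⁻ ω, (if ω ∈ hitBefore G m then 1 else
        failExtend (fun x => if x ∈ G then 1 else ∑' y, C.P x y * r y) (ω m))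
          ∂C.pathMeasure := by
  let g : ((i : Finset.Iic m) → (fun _ : ℕ => WithFail X) i) × WithFail X → ℝ≥0∞ :=
    fun p => if ∃ k, p.1 k ∈ embed G then 1 else failExtend r p.2
  have hS : MeasurableSet {p : ((i : Finset.Iic m) → (fun _ : ℕ => WithFail X) i) × WithFail X |
      ∃ k, p.1 k ∈ embed G} := by
    have : {p : ((i : Finset.Iic m) → (fun _ : ℕ => WithFail X) i) × WithFail X |
      ∃ k, p.1 k ∈ embed G} = ⋃ k, (fun p => p.1 k) ⁻¹' embed G := by
      ext; simp
    rw [this]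
    exact MeasurableSet.iUnion fun k =>
      ((measurable_pi_apply k).comp measurable_fst) MeasurableSpace.measurableSet_top
  have hg : Measurable g :=
    Measurable.ite hS measurable_const ((measurable_of_withFail (failExtend r)).comp measurable_snd)
  have hmem (ω : ℕ → WithFail X) : (∃ k, Preorder.frestrictLe m ω k ∈ embed G) ↔
      ω ∈ hitBefore G (m + 1) := by
    simp [hitBefore, Preorder.frestrictLe]
  have h := C.lintegral_pathMeasure_succ m g hg
  simp only [g, hmem] at h
  rw [h]
  refine lintegral_congr fun ω => ?_
  by_cases h1 : ω ∈ hitBefore G m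
  · have h2 : ω ∈ hitBefore G (m + 1) := by
      obtain ⟨k, hk, h3⟩ := h1
      exact ⟨k, by omega, h3⟩
    simp [h1, h2]
  · by_cases h2 : ω ∈ hitBefore G (m + 1)
    · obtain ⟨k, hk, x, hx, hkx⟩ := h2
      have hkm : k = m := by
        by_contra hne
        exact h1 ⟨k, by omega, x, hx, hkx⟩
      subst hkm
      have h2 : ω ∈ hitBefore G (k + 1) := ⟨k, hk, x, hx, hkx⟩
      simp [h1, h2, hkx, failExtend, hx]
    · simp only [h1, h2, if_false, lintegral_step]
      cases hω : ω m with
      | none => rfl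
      | some x =>
        have hx : x ∉ G := fun hx => h2 ⟨m, by omega, x, hx, hω⟩
        simp [failExtend, hx]

theorem pathMeasure_hitBefore (G : Set X) (n : ℕ) :
    C.pathMeasure (hitBefore G n) = ∑' x, C.init x * C.hitProb G n x := by
  classical
  -- The last `k` of the `m + k` steps are replaced by their probability, so only `m + k` matters.
  -- The case `k = 0` is the event itself, and `m = 0` is an integral against the initial
  -- distribution.
  have key (m k : ℕ) : ∫⁻ ω, (if ω ∈ hitBefore G m then 1 else
      failExtend (C.hitProb G k) (ω m)) ∂C.pathMeasure =
        ∑' x, C.init x * C.hitProb G (m + k) x := by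
    induction m generalizing k with
    | zero =>
      simp only [hitBefore, Nat.not_lt_zero, false_and, exists_false, Set.mem_ofPred_eq, if_false]
      rw [lintegral_pathMeasure_zero, lintegral_completePMF, Nat.zero_add]
    | succ m ih =>
      rw [lintegral_hitBefore_succ, show m + 1 + k = m + (k + 1) by omega, ← ih]
      rfl
  have h0 (o : WithFail X) : failExtend (C.hitProb G 0) o = 0 := by cases o <;> rfl
  rw [← add_zero n, ← key n 0, add_zero]
  simp only [h0]
  rw [← lintegral_indicator_one (measurableSet_hitBefore G n)]
  rfl

theorem eventually_eq_iUnion (G : Set X) : eventually G = ⋃ n, hitBefore G n := by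
  ext ω
  simp only [eventually, hitBefore, Set.mem_ofPred_eq, Set.mem_iUnion]
  exact ⟨fun ⟨n, h⟩ => ⟨n + 1, n, n.lt_succ_self, h⟩, fun ⟨_, k, _, h⟩ => ⟨k, h⟩⟩

theorem pathMeasure_eventually (G : Set X) :
    C.pathMeasure (eventually G) = ⨆ n, ∑' x, C.init x * C.hitProb G n x := by
  have hm : Monotone (hitBefore G) := fun a b hab ω ⟨k, hk, h⟩ => ⟨k, hk.trans_le hab, h⟩
  rw [eventually_eq_iUnion, hm.measure_iUnion]
  simp only [pathMeasure_hitBefore]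

end DTMC

/-! ### Monotone limits and optima over finite action sets -/

namespace ENNReal

theorem tsum_mul_iSup_of_monotone {Y : Type*} (p : Y → ℝ≥0∞) {f : ℕ → Y → ℝ≥0∞}
    (hf : Monotone f) : ∑' y, p y * ⨆ n, f n y = ⨆ n, ∑' y, p y * f n y := by
  simp only [ENNReal.tsum_eq_iSup_sum, ENNReal.mul_iSup]
  rw [iSup_comm]
  refine iSup_congr fun s => ?_
  exact ENNReal.finsetSum_iSup_of_monotone fun y a b hab => mul_le_mul_right (hf hab y) _

end ENNReal

namespace Extremum

variable {A : Type v}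

/-- The supremum, respectively infimum, of a function over a finite set. -/
noncomputable def optimum (v : Extremum) (s : Finset A) (φ : A → ℝ≥0∞) : ℝ≥0∞ :=
  match v with
  | .max => ⨆ α : s, φ α
  | .min => ⨅ α : s, φ α

theorem optimum_mono (v : Extremum) {s : Finset A} {φ ψ : A → ℝ≥0∞} (h : ∀ α ∈ s, φ α ≤ ψ α) :
    v.optimum s φ ≤ v.optimum s ψ := by
  cases v with
  | max => exact iSup_mono fun α => h α α.2
  | min => exact iInf_mono fun α => h α α.2

theorem optimum_congr (v : Extremum) {s : Finset A} {φ ψ : A → ℝ≥0∞} (h : ∀ α ∈ s, φ α = ψ α) :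
    v.optimum s φ = v.optimum s ψ :=
  (v.optimum_mono fun α hα => (h α hα).le).antisymm (v.optimum_mono fun α hα => (h α hα).ge)

theorem exists_eq_optimum (v : Extremum) {s : Finset A} (hs : s.Nonempty) (φ : A → ℝ≥0∞) :
    ∃ α ∈ s, φ α = v.optimum s φ := by
  have : Nonempty s := hs.to_subtype
  cases v with
  | max =>
    obtain ⟨α, hα⟩ := exists_eq_ciSup_of_finite (f := fun α : s => φ α)
    exact ⟨α, α.2, hα⟩
  | min =>
    obtain ⟨α, hα⟩ := exists_eq_ciInf_of_finite (f := fun α : s => φ α)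
    exact ⟨α, α.2, hα⟩

/-- For the minimum this depends on `s` being finite: an infimum over infinitely many actions need
not commute with an increasing limit. -/
theorem optimum_iSup (v : Extremum) (s : Finset A) {φ : ℕ → A → ℝ≥0∞} (hφ : Monotone φ) :
    v.optimum s (fun α => ⨆ n, φ n α) = ⨆ n, v.optimum s (φ n) := by
  cases v with
  | max => exact iSup_comm
  | min => exact (iSup_iInf_of_monotone fun α : s => fun a b hab => hφ hab α).symm

theorem optimum_singleton (v : Extremum) (a : A) (φ : A → ℝ≥0∞) : v.optimum {a} φ = φ a := by
  obtain ⟨α, hα, h⟩ := v.exists_eq_optimum (Finset.singleton_nonempty a) φ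
  rw [← h, Finset.mem_singleton.1 hα]

theorem optimum_map {A' : Type*} (v : Extremum) (s : Finset A) (e : A ↪ A') (φ : A' → ℝ≥0∞) :
    v.optimum (s.map e) φ = v.optimum s (fun α => φ (e α)) := by
  cases v with
  | max =>
    simp only [optimum, iSup_subtype, Finset.mem_map, iSup_exists, iSup_and]
    rw [iSup_comm]
    refine iSup_congr fun a => ?_
    rw [iSup_comm]
    simp only [iSup_iSup_eq_right]
  | min =>
    simp only [optimum, iInf_subtype, Finset.mem_map, iInf_exists, iInf_and]
    rw [iInf_comm]
    refine iInf_congr fun a => ?_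
    rw [iInf_comm]
    simp only [iInf_iInf_eq_right]

end Extremum

/-! ### Value iteration and optimal schedulers -/

namespace MDP

variable {S : Type u} {A : Type v} (M : MDP S A)

theorem hitProb_induced_succ (σ : M.Scheduler) (G : Set S) (n : ℕ) (h : List (S × A)) (s : S)
    (hs : s ∉ G) :
    (M.induced σ).hitProb {p | p.2 ∈ G} (n + 1) (h, s) =
      ∑' t, M.P s (σ.choose h s) t *
        (M.induced σ).hitProb {p | p.2 ∈ G} n (h ++ [(s, σ.choose h s)], t) := by
  have hs' : (h, s) ∉ {p : List (S × A) × S | p.2 ∈ G} := hs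
  rw [DTMC.hitProb, if_neg hs', ENNReal.tsum_prod', ENNReal.tsum_comm]
  refine tsum_congr fun t => ?_
  rw [tsum_eq_single (h ++ [(s, σ.choose h s)])]
  · simp [induced]
  · intro h' hh'
    simp [induced, hh']

theorem hitProb_induced_of_mem (σ : M.Scheduler) (G : Set S) (n : ℕ) (h : List (S × A)) (s : S)
    (hs : s ∈ G) : (M.induced σ).hitProb {p | p.2 ∈ G} (n + 1) (h, s) = 1 :=
  if_pos hs

theorem reachProb_startAt (q : S) (G : Set S) (σ : (M.startAt q).Scheduler) :
    (M.startAt q).reachProb G σ =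
      ⨆ n, ((M.startAt q).induced σ).hitProb {p | p.2 ∈ G} n ([], q) := by
  rw [reachProb, DTMC.pathMeasure_eventually]
  refine iSup_congr fun n => ?_
  rw [tsum_eq_single ([], q)]
  · simp [induced, startAt]
  · rintro ⟨h, s⟩ hne
    simp only [induced, startAt]
    split_ifs with h1 h2
    · exact absurd (Prod.ext h1 h2) hne
    · simp
    · simp

open Classical in
/-- The Bellman operator for reaching `G`. -/
noncomputable def bellman (v : Extremum) (G : Set S) (V : S → ℝ≥0∞) (s : S) : ℝ≥0∞ :=
  if s ∈ G then 1 else v.optimum (M.Act s) fun α => ∑' t, M.P s α t * V t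

theorem bellman_of_mem (v : Extremum) {G : Set S} (V : S → ℝ≥0∞) {s : S} (hs : s ∈ G) :
    M.bellman v G V s = 1 :=
  if_pos hs

theorem bellman_of_notMem (v : Extremum) {G : Set S} (V : S → ℝ≥0∞) {s : S} (hs : s ∉ G) :
    M.bellman v G V s = v.optimum (M.Act s) fun α => ∑' t, M.P s α t * V t :=
  if_neg hs

theorem bellman_mono (v : Extremum) (G : Set S) : Monotone (M.bellman v G) := by
  intro V W h s
  by_cases hs : s ∈ G
  · simp only [bellman_of_mem _ _ _ hs, le_refl]
  · simp only [bellman_of_notMem _ _ _ hs]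
    exact v.optimum_mono fun α _ => ENNReal.tsum_le_tsum fun t => mul_le_mul_right (h t) _

/-- The optimal probability of visiting `G` in fewer than `n` steps. -/
noncomputable def stepValue (v : Extremum) (G : Set S) : ℕ → S → ℝ≥0∞
  | 0 => 0
  | n + 1 => M.bellman v G (stepValue v G n)

/-- The optimal probability of visiting `G`, obtained by value iteration. -/
noncomputable def value (v : Extremum) (G : Set S) (s : S) : ℝ≥0∞ :=
  ⨆ n, M.stepValue v G n s

theorem stepValue_mono (v : Extremum) (G : Set S) : Monotone (M.stepValue v G) := by
  refine monotone_nat_of_le_succ fun n => ?_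
  induction n with
  | zero => exact fun _ => zero_le
  | succ n ih => exact M.bellman_mono v G ih

/-- The operator commutes with increasing limits, by monotone convergence and `optimum_iSup`, so the
limit of the iterates from `0` is fixed. -/
theorem bellman_value (v : Extremum) (G : Set S) : M.bellman v G (M.value v G) = M.value v G := by
  funext s
  have hmono := M.stepValue_mono v G
  have h1 : M.value v G s = ⨆ n, M.stepValue v G (n + 1) s :=
    (Monotone.iSup_nat_add (f := fun n => M.stepValue v G n s) (fun a b hab => hmono hab s) 1).symm
  rw [h1]
  by_cases hs : s ∈ G
  · simp only [stepValue, bellman_of_mem _ _ _ hs, ciSup_const]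
  · simp only [stepValue, bellman_of_notMem _ _ _ hs, value]
    simp only [ENNReal.tsum_mul_iSup_of_monotone _ hmono]
    exact v.optimum_iSup _ fun a b hab α =>
      ENNReal.tsum_le_tsum fun t => mul_le_mul_right (hmono hab t) _

theorem value_le_of_bellman_le (v : Extremum) (G : Set S) {W : S → ℝ≥0∞}
    (h : M.bellman v G W ≤ W) : M.value v G ≤ W := by
  intro s
  refine iSup_le fun n => ?_
  revert s
  change M.stepValue v G n ≤ W
  induction n with
  | zero => exact fun _ => zero_le
  | succ n ih => exact (M.bellman_mono v G ih).trans h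

theorem hitProb_le_stepValue (σ : M.Scheduler) (G : Set S) (n : ℕ) (h : List (S × A)) (s : S) :
    (M.induced σ).hitProb {p | p.2 ∈ G} n (h, s) ≤ M.stepValue .max G n s := by
  induction n generalizing h s with
  | zero => exact le_rfl
  | succ n ih =>
    by_cases hs : s ∈ G
    · rw [hitProb_induced_of_mem _ _ _ _ _ _ hs, stepValue, bellman_of_mem _ _ _ hs]
    · rw [hitProb_induced_succ _ _ _ _ _ _ hs, stepValue, bellman_of_notMem _ _ _ hs]
      exact (ENNReal.tsum_le_tsum fun t => mul_le_mul_right (ih _ t) _).trans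
        (le_iSup (fun α : M.Act s => ∑' t, M.P s α t * M.stepValue .max G n t)
          ⟨_, σ.choose_mem h s⟩)

theorem stepValue_le_hitProb (σ : M.Scheduler) (G : Set S) (n : ℕ) (h : List (S × A)) (s : S) :
    M.stepValue .min G n s ≤ (M.induced σ).hitProb {p | p.2 ∈ G} n (h, s) := by
  induction n generalizing h s with
  | zero => exact le_rfl
  | succ n ih =>
    by_cases hs : s ∈ G
    · rw [hitProb_induced_of_mem _ _ _ _ _ _ hs, stepValue, bellman_of_mem _ _ _ hs]
    · rw [hitProb_induced_succ _ _ _ _ _ _ hs, stepValue, bellman_of_notMem _ _ _ hs]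
      exact (iInf_le (fun α : M.Act s => ∑' t, M.P s α t * M.stepValue .min G n t)
          ⟨_, σ.choose_mem h s⟩).trans
        (ENNReal.tsum_le_tsum fun t => mul_le_mul_right (ih _ t) _)

theorem exists_scheduler_hitProb_eq (v : Extremum) (G : Set S) (n : ℕ) :
    ∃ σ : M.Scheduler, ∀ s,
      (M.induced σ).hitProb {p | p.2 ∈ G} n ([], s) = M.stepValue v G n s := by
  choose a ha hopt using fun (k : ℕ) (s : S) =>
    v.exists_eq_optimum (M.act_nonempty s) fun α => ∑' t, M.P s α t * M.stepValue v G k t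
  -- The history length serves as a clock. Of the `n - h.length` remaining visits the current state
  -- uses one, so the action is chosen optimal for the horizon `n - 1 - h.length`.
  let σ : M.Scheduler := ⟨fun h s => a (n - 1 - h.length) s, fun h s => ha _ s⟩
  have key (k : ℕ) : ∀ h s, h.length + k = n →
      (M.induced σ).hitProb {p | p.2 ∈ G} k (h, s) = M.stepValue v G k s := by
    induction k with
    | zero => exact fun _ _ _ => rfl
    | succ k ih =>
      intro h s hk
      by_cases hs : s ∈ G
      · rw [hitProb_induced_of_mem _ _ _ _ _ _ hs, stepValue, bellman_of_mem _ _ _ hs]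
      · have hlen : n - 1 - h.length = k := by omega
        rw [hitProb_induced_succ _ _ _ _ _ _ hs, stepValue, bellman_of_notMem _ _ _ hs, ← hopt]
        simp only [σ, hlen]
        refine tsum_congr fun t => ?_
        rw [← ih _ t]
        simp only [List.length_append, List.length_singleton]
        omega
  exact ⟨σ, fun s => key n [] s (by simp)⟩

/-- A memoryless scheduler, optimal in the Bellman equation of `value`, works for all step bounds at
once: by induction its bounded-step probabilities never exceed the fixed point. -/
theorem exists_scheduler_hitProb_le (v : Extremum) (G : Set S) :
    ∃ σ : M.Scheduler, ∀ n h s,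
      (M.induced σ).hitProb {p | p.2 ∈ G} n (h, s) ≤ M.value v G s := by
  choose a ha hopt using fun s : S =>
    v.exists_eq_optimum (M.act_nonempty s) fun α => ∑' t, M.P s α t * M.value v G t
  refine ⟨⟨fun _ s => a s, fun _ s => ha s⟩, fun n => ?_⟩
  induction n with
  | zero => exact fun _ _ => zero_le
  | succ n ih =>
    intro h s
    rw [← bellman_value]
    by_cases hs : s ∈ G
    · rw [hitProb_induced_of_mem _ _ _ _ _ _ hs, bellman_of_mem _ _ _ hs]
    · rw [hitProb_induced_succ _ _ _ _ _ _ hs, bellman_of_notMem _ _ _ hs, ← hopt]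
      exact ENNReal.tsum_le_tsum fun t => mul_le_mul_right (ih _ t) _

theorem value_startAt (v : Extremum) (G : Set S) (q : S) :
    (M.startAt q).value v G = M.value v G := by
  have h (n : ℕ) : (M.startAt q).stepValue v G n = M.stepValue v G n := by
    induction n with
    | zero => rfl
    | succ n ih => rw [stepValue, stepValue, ih]; rfl
  funext s
  simp only [value, h]

/-- For the maximum, the suprema over schedulers and step bounds commute, so a separate scheduler
for each bound suffices. For the minimum, the infimum and the supremum need not commute, and the
memoryless scheduler gives the upper bound. -/
theorem optProb_startAt (v : Extremum) (G : Set S) (q : S) :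
    (M.startAt q).optProb v G = M.value v G q := by
  rw [← M.value_startAt v G q]
  cases v with
  | max =>
    refine le_antisymm (iSup_le fun σ => ?_) (iSup_le fun n => ?_)
    · rw [reachProb_startAt]
      exact iSup_mono fun n => hitProb_le_stepValue _ σ G n [] q
    · obtain ⟨σ, hσ⟩ := (M.startAt q).exists_scheduler_hitProb_eq .max G n
      rw [← hσ q]
      refine le_trans ?_ (le_iSup _ σ)
      rw [reachProb_startAt]
      exact le_iSup (fun n => ((M.startAt q).induced σ).hitProb {p | p.2 ∈ G} n ([], q)) n
  | min =>
    refine le_antisymm ?_ (le_iInf fun σ => ?_)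
    · obtain ⟨σ, hσ⟩ := (M.startAt q).exists_scheduler_hitProb_le .min G
      refine (iInf_le _ σ).trans ?_
      rw [reachProb_startAt]
      exact iSup_le fun n => hσ n [] q
    · rw [reachProb_startAt]
      exact iSup_mono fun n => stepValue_le_hitProb _ σ G n [] q

end MDP

/-! ### Bellman equations for subsystems and cuts -/

namespace MDP

variable {S : Type u} {A : Type v} (M : MDP S A)

theorem bellman_le_of_edge (v : Extremum) (G : Set S) {V W : S → ℝ≥0∞} {s : S}
    (h : ∀ t, M.Edge s t → V t ≤ W t) : M.bellman v G V s ≤ M.bellman v G W s := by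
  by_cases hs : s ∈ G
  · simp only [bellman_of_mem _ _ _ hs, le_refl]
  · simp only [bellman_of_notMem _ _ _ hs]
    refine v.optimum_mono fun α hα => ENNReal.tsum_le_tsum fun t => ?_
    rcases eq_or_ne (M.P s α t) 0 with h0 | h0
    · simp [h0]
    · exact mul_le_mul_right (h t ⟨α, hα, pos_iff_ne_zero.2 h0⟩) _

/-- Over a set outside of which `F` vanishes, a sum can be extended to the whole type. -/
theorem tsum_subtype_mul_eq {T : Set S} (p : S → ℝ≥0∞) {F : S → ℝ≥0∞} (hF : ∀ t ∉ T, F t = 0) :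
    ∑' t : T, p t * F t = ∑' t, p t * F t :=
  tsum_subtype_eq_of_support_subset (f := fun t => p t * F t) fun t ht => by
    by_contra h
    exact ht (by simp [hF t h])

theorem tsum_subtype_mul_le (T : Set S) (p F : S → ℝ≥0∞) :
    ∑' t : T, p t * F t ≤ ∑' t, p t * F t :=
  ENNReal.tsum_comp_le_tsum_of_injective Subtype.val_injective fun t => p t * F t

section val

variable (v : Extremum) (G T : Set S)

theorem val_of_notMem {q : S} (h : q ∉ T) : M.val v G T q = 0 :=
  dif_neg h

theorem val_coe (q : T) :
    M.val v G T q = (M.induce T).value v {t | (t : S) ∈ G} q := by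
  rw [val, dif_pos q.2, optProb_startAt]

/-- Since `val` vanishes off `T`, the operator of `M` can stand in for that of the subsystem, so
that different subsystems are compared with one operator. -/
theorem bellman_val {q : S} (hq : q ∈ T) :
    M.bellman v G (M.val v G T) q = M.val v G T q := by
  have h := congrFun ((M.induce T).bellman_value v {t | (t : S) ∈ G}) ⟨q, hq⟩
  rw [← val_coe] at h
  rw [← h]
  by_cases hG : q ∈ G
  · rw [bellman_of_mem _ _ _ hG, bellman_of_mem _ _ _ (show _ ∈ {t : T | (t : S) ∈ G} from hG)]
  · rw [bellman_of_notMem _ _ _ hG,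
      bellman_of_notMem _ _ _ (show _ ∉ {t : T | (t : S) ∈ G} from hG)]
    refine v.optimum_congr fun α _ => ?_
    rw [← tsum_subtype_mul_eq _ fun t ht => M.val_of_notMem v G T ht]
    exact tsum_congr fun t => by rw [val_coe]; rfl

theorem val_eq_one {q : S} (hq : q ∈ T) (hG : q ∈ G) : M.val v G T q = 1 := by
  rw [← bellman_val _ _ _ _ hq, bellman_of_mem _ _ _ hG]

theorem val_le {W : S → ℝ≥0∞} (hW : ∀ q ∈ T, M.bellman v G W q ≤ W q) (q : S) :
    M.val v G T q ≤ W q := by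
  by_cases hq : q ∈ T
  · rw [M.val_coe v G T ⟨q, hq⟩]
    refine (M.induce T).value_le_of_bellman_le v {t | (t : S) ∈ G} (W := fun t => W t) ?_ ⟨q, hq⟩
    intro t
    refine le_trans ?_ (hW t t.2)
    by_cases hG : (t : S) ∈ G
    · rw [bellman_of_mem _ _ _ hG, bellman_of_mem _ _ _ (show _ ∈ {t : T | (t : S) ∈ G} from hG)]
    · rw [bellman_of_notMem _ _ _ hG,
        bellman_of_notMem _ _ _ (show _ ∉ {t : T | (t : S) ∈ G} from hG)]
      exact v.optimum_mono fun α _ => tsum_subtype_mul_le T _ W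
  · rw [val_of_notMem _ _ _ _ hq]
    exact zero_le

end val

section cut

variable (v : Extremum) (G T D : Set S) (f : S → ℝ≥0∞) (hf : ∀ s ∈ D, f s ≤ 1)

/-- The goal states of `M.cut T D f hf`. -/
def cutGoal : Set (T ⊕ Unit) := insert (.inr ()) (Sum.inl '' {t : T | (t : S) ∈ G})

theorem inl_mem_cutGoal (t : T) : Sum.inl t ∈ cutGoal G T ↔ (t : S) ∈ G := by
  simp [cutGoal]

theorem inr_mem_cutGoal : Sum.inr () ∈ cutGoal G T :=
  Set.mem_insert _ _

theorem bellman_cut_inl_of_mem (W : T ⊕ Unit → ℝ≥0∞) {q : T} (hG : (q : S) ∉ G)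
    (hD : (q : S) ∈ D) :
    (M.cut T D f hf).bellman v (cutGoal G T) W (.inl q) = f q * W (.inr ()) := by
  rw [bellman_of_notMem _ _ _ (by rwa [inl_mem_cutGoal])]
  have h : (M.cut T D f hf).Act (.inl q) = {none} := if_pos hD
  rw [h, Extremum.optimum_singleton, Summable.tsum_sum ENNReal.summable ENNReal.summable]
  simp [cut, hD]

theorem bellman_cut_inl_of_notMem (W : T ⊕ Unit → ℝ≥0∞) {q : T} (hG : (q : S) ∉ G)
    (hD : (q : S) ∉ D) :
    (M.cut T D f hf).bellman v (cutGoal G T) W (.inl q) =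
      v.optimum (M.Act q) fun α => ∑' t : T, M.P q α t * W (.inl t) := by
  rw [bellman_of_notMem _ _ _ (by rwa [inl_mem_cutGoal])]
  have h : (M.cut T D f hf).Act (.inl q) = (M.Act q).map Function.Embedding.some := if_neg hD
  rw [h, Extremum.optimum_map]
  refine v.optimum_congr fun α _ => ?_
  rw [Summable.tsum_sum ENNReal.summable ENNReal.summable]
  simp [cut, hD]

theorem cutVal_eq_value (q : T) :
    M.cutVal v G T D f hf q = (M.cut T D f hf).value v (cutGoal G T) (.inl q) :=
  optProb_startAt _ _ _ _

theorem bellman_value_inl (q : T) :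
    (M.cut T D f hf).bellman v (cutGoal G T)
      ((M.cut T D f hf).value v (cutGoal G T)) (.inl q) = M.cutVal v G T D f hf q := by
  rw [bellman_value, cutVal_eq_value]

theorem cutVal_of_mem_goal {q : T} (hG : (q : S) ∈ G) : M.cutVal v G T D f hf q = 1 := by
  rw [← bellman_value_inl, bellman_of_mem _ _ _ (by rwa [inl_mem_cutGoal])]

theorem cutVal_of_mem {q : T} (hG : (q : S) ∉ G) (hD : (q : S) ∈ D) :
    M.cutVal v G T D f hf q = f q := by
  rw [← bellman_value_inl, bellman_cut_inl_of_mem _ _ _ _ _ _ _ _ hG hD, ← bellman_value,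
    bellman_of_mem _ _ _ (inr_mem_cutGoal G T), mul_one]

theorem bellman_cutVal {W : S → ℝ≥0∞} (hW : ∀ t : T, W t = M.cutVal v G T D f hf t)
    (hW0 : ∀ t ∉ T, W t = 0) {q : T} (hD : (q : S) ∉ D) :
    M.bellman v G W q = M.cutVal v G T D f hf q := by
  by_cases hG : (q : S) ∈ G
  · rw [bellman_of_mem _ _ _ hG, cutVal_of_mem_goal _ _ _ _ _ _ _ hG]
  · rw [← bellman_value_inl, bellman_of_notMem _ _ _ hG,
      bellman_cut_inl_of_notMem _ _ _ _ _ _ _ _ hG hD]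
    refine v.optimum_congr fun α _ => ?_
    rw [← tsum_subtype_mul_eq _ hW0]
    exact tsum_congr fun t => by rw [hW, cutVal_eq_value]

theorem cutVal_le {W : S → ℝ≥0∞} (hG : ∀ q ∈ T, q ∈ G → 1 ≤ W q)
    (hD : ∀ q ∈ T, q ∈ D → f q ≤ W q)
    (hW : ∀ q ∈ T, q ∉ D → q ∉ G → M.bellman v G W q ≤ W q) (q : T) :
    M.cutVal v G T D f hf q ≤ W q := by
  rw [cutVal_eq_value]
  refine (M.cut T D f hf).value_le_of_bellman_le v (cutGoal G T)
    -- The added goal state has value `1`.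
    (W := Sum.elim (fun t => W t) fun _ => 1) ?_ (.inl q)
  rintro (t | t)
  · by_cases htG : (t : S) ∈ G
    · rw [bellman_of_mem _ _ _ (by rwa [inl_mem_cutGoal])]
      exact hG t t.2 htG
    · by_cases htD : (t : S) ∈ D
      · rw [bellman_cut_inl_of_mem _ _ _ _ _ _ _ _ htG htD]
        simpa using hD t t.2 htD
      · rw [bellman_cut_inl_of_notMem _ _ _ _ _ _ _ _ htG htD]
        refine le_trans ?_ (hW t t.2 htD htG)
        rw [bellman_of_notMem _ _ _ htG]
        exact v.optimum_mono fun α _ => tsum_subtype_mul_le T _ W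
  · rw [bellman_of_mem _ _ _ (inr_mem_cutGoal G T)]
    rfl

end cut

/-- Cutting a subsystem `S'` along an interface `D`, through which every edge from `S' \ S₂` into
the edge-closed part `S₂` passes. -/
theorem val_eq_cutVal (v : Extremum) {Goal G S' S₂ D T : Set S} (hS₂ : S₂ ⊆ S')
    (hT : T = S' \ S₂ ∪ D) (hD : D ∩ S' ⊆ S₂)
    (hclosed : ∀ s ∈ S₂, ∀ t ∈ S', M.Edge s t → t ∈ S₂)
    (hinterface : ∀ s ∈ S' \ S₂, ∀ t ∈ S₂, M.Edge s t → t ∈ D)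
    (hG : G ⊆ Goal) (hGoal : Goal \ D ⊆ G) (hGD : G ∩ D ⊆ S')
    (hf : ∀ s ∈ D, M.val v Goal S₂ s ≤ 1) (q : T) :
    M.val v Goal S' q = M.cutVal v G T D (M.val v Goal S₂) hf q := by
  classical
  have hmemT (t : S) : t ∈ T ↔ (t ∈ S' ∧ t ∉ S₂) ∨ t ∈ D := by rw [hT]; rfl
  -- `G` and `Goal` can differ only inside `D`.
  have hbell (W : S → ℝ≥0∞) {s : S} (hs : s ∉ D) :
      M.bellman v G W s = M.bellman v Goal W s := by
    by_cases h : s ∈ Goal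
    · rw [bellman_of_mem _ _ _ h, bellman_of_mem _ _ _ (hGoal ⟨h, hs⟩)]
    · rw [bellman_of_notMem _ _ _ h, bellman_of_notMem _ _ _ fun h' => h (hG h')]
  -- Whether states of `D` count as goals is immaterial: a state of `G ∩ D` lies in `S'`, hence in
  -- `S₂`, where its value is already `1`.
  have hcutD (t : T) (ht : (t : S) ∈ D) :
      M.cutVal v G T D (M.val v Goal S₂) hf t = M.val v Goal S₂ t := by
    by_cases htG : (t : S) ∈ G
    · rw [cutVal_of_mem_goal _ _ _ _ _ _ _ htG,
        val_eq_one _ _ _ _ (hD ⟨ht, hGD ⟨htG, ht⟩⟩) (hG htG)]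
    · exact cutVal_of_mem _ _ _ _ _ _ _ htG ht
  apply le_antisymm
  · let C : S → ℝ≥0∞ := fun t => if h : t ∈ T then M.cutVal v G T D (M.val v Goal S₂) hf ⟨t, h⟩
      else 0
    -- The glued bound: the two pieces agree on `D`, so `W` is `val` of `S₂` on all of `S₂`.
    let W : S → ℝ≥0∞ := fun t => if t ∈ T then C t else M.val v Goal S₂ t
    have hC (t : T) : C t = M.cutVal v G T D (M.val v Goal S₂) hf t := dif_pos t.2
    have hC0 (t : S) (ht : t ∉ T) : C t = 0 := dif_neg ht
    have hWT {t : S} (ht : t ∈ T) : W t = C t := if_pos ht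
    have hWD {t : S} (ht : t ∈ D) : W t = M.val v Goal S₂ t := by
      have htT : t ∈ T := (hmemT t).2 (.inr ht)
      rw [hWT htT, hC ⟨t, htT⟩, hcutD ⟨t, htT⟩ ht]
    have hWS₂ {t : S} (ht : t ∈ S₂ ∨ t ∉ S') : W t = M.val v Goal S₂ t := by
      by_cases htD : t ∈ D
      · exact hWD htD
      · refine if_neg ?_
        rw [hmemT]
        tauto
    have h : M.val v Goal S' q ≤ W q := by
      refine M.val_le v Goal S' (fun s hs => ?_) q
      by_cases hs₂ : s ∈ S₂
      · rw [hWS₂ (.inl hs₂), ← bellman_val _ _ _ _ hs₂]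
        refine M.bellman_le_of_edge v Goal fun t hst => (hWS₂ ?_).le
        by_cases ht : t ∈ S'
        · exact .inl (hclosed s hs₂ t ht hst)
        · exact .inr ht
      · have hsD : s ∉ D := fun h => hs₂ (hD ⟨h, hs⟩)
        have hsT : s ∈ T := (hmemT s).2 (.inl ⟨hs, hs₂⟩)
        rw [hWT hsT, hC ⟨s, hsT⟩, ← M.bellman_cutVal v G T D _ hf hC hC0 hsD, hbell _ hsD]
        refine M.bellman_le_of_edge v Goal fun t hst => ?_
        by_cases ht : t ∈ T
        · exact (hWT ht).le
        · have h1 : W t = M.val v Goal S₂ t := if_neg ht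
          rw [h1, val_of_notMem]
          · exact zero_le
          · exact fun ht₂ => ht ((hmemT t).2 (.inr (hinterface s ⟨hs, hs₂⟩ t ht₂ hst)))
    rw [← hC, ← hWT q.2]
    exact h
  -- Conversely, `val` of `S'` is tested as an upper bound for the cut. On `D` this needs only that
  -- `val` of `S₂` is at most `val` of `S'`.
  · refine M.cutVal_le v G T D _ hf (fun s hs hsG => ?_) (fun s _ _ => ?_)
      (fun s hs hsD _ => ?_) q
    · refine (M.val_eq_one v Goal S' ?_ (hG hsG)).ge
      rcases (hmemT s).1 hs with h | h
      · exact h.1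
      · exact hGD ⟨hsG, h⟩
    · exact M.val_le v Goal S₂ (fun t ht => (M.bellman_val v Goal S' (hS₂ ht)).le) s
    · rw [hbell _ hsD, bellman_val]
      exact ((hmemT s).1 hs).elim (fun h => h.1) fun h => absurd h hsD

end MDP

/-! ### Edges across a directed tree partition -/

namespace IsDirectedTree

/-- In an acyclic graph the closing edge would be a bridge, yet the directed path from `B` to `C`
still connects its ends after its removal. -/
theorem not_edge_of_reflTransGen {V : Type*} {E : V → V → Prop} (h : IsDirectedTree E) {B C : V}
    (hBC : Relation.ReflTransGen E B C) : ¬ E C B := by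
  intro hCB
  have hadj {x y : V} (hxy : E x y) : (SimpleGraph.fromRel E).Adj x y :=
    (SimpleGraph.fromRel_adj _ _ _).2 ⟨fun he => h.asymm x y hxy (by subst he; exact hxy), .inl hxy⟩
  have hbridge := SimpleGraph.isAcyclic_iff_forall_adj_isBridge.1 h.isTree.isAcyclic (hadj hCB)
  rw [SimpleGraph.isBridge_iff] at hbridge
  refine hbridge (SimpleGraph.Reachable.symm ?_)
  suffices key : ∀ x, Relation.ReflTransGen E B x →
      ((SimpleGraph.fromRel E).deleteEdges {s(C, B)}).Reachable B x from key C hBC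
  intro x hx
  induction hx with
  | refl => exact .refl _
  | @tail x y _ hxy ih =>
    -- A step along the removed edge either returns to the start `B` or opposes `E C B`, which
    -- asymmetry excludes.
    by_cases he : s(x, y) = s(C, B)
    · rcases Sym2.eq_iff.1 he with ⟨-, rfl⟩ | ⟨rfl, rfl⟩
      · exact .refl _
      · exact absurd hxy (h.asymm _ _ hCB)
    · exact ih.trans (SimpleGraph.Adj.reachable
        (SimpleGraph.deleteEdges_adj.2 ⟨hadj hxy, he⟩))

end IsDirectedTree

namespace IsDirectedTreePartition

variable {S : Type u} {E : S → S → Prop} {Ps : Set (Set S)}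

theorem exists_block (h : IsDirectedTreePartition E Ps) (s : S) : ∃ C ∈ Ps, s ∈ C := by
  obtain ⟨C, hC, -⟩ := h.isPartition.2 s
  exact ⟨C, hC⟩

theorem block_unique (h : IsDirectedTreePartition E Ps) {s : S} {C D : Set S} (hC : C ∈ Ps)
    (hsC : s ∈ C) (hD : D ∈ Ps) (hsD : s ∈ D) : C = D :=
  (h.isPartition.2 s).unique ⟨hC, hsC⟩ ⟨hD, hsD⟩

end IsDirectedTreePartition

namespace MDP

variable {S : Type u} {A : Type v} (M : MDP S A) {Ps : Set (Set S)} {B : Set S}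

theorem mem_cl {s : S} :
    s ∈ M.cl Ps B ↔ ∃ C, Relation.ReflTransGen (M.IsParent Ps) B C ∧ s ∈ C := by
  simp [cl]

theorem mem_of_reflTransGen_isParent (hB : B ∈ Ps) {C : Set S}
    (h : Relation.ReflTransGen (M.IsParent Ps) B C) : C ∈ Ps := by
  cases h with
  | refl => exact hB
  | tail _ h => exact h.2.1

theorem not_isParent_of_reflTransGen (hPs : IsDirectedTreePartition M.Edge Ps) (hB : B ∈ Ps)
    {C : Set S} (h : Relation.ReflTransGen (M.IsParent Ps) B C) : ¬ M.IsParent Ps C B := by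
  suffices key : ∃ hC : C ∈ Ps,
      Relation.ReflTransGen (fun B C : Ps => QuotEdge M.Edge B C) ⟨B, hB⟩ ⟨C, hC⟩ by
    obtain ⟨hC, hBC⟩ := key
    exact fun hCB => hPs.isDirectedTree.not_edge_of_reflTransGen hBC hCB.2.2
  induction h with
  | refl => exact ⟨hB, .refl⟩
  | tail _ hxy ih =>
    obtain ⟨hx, hBx⟩ := ih
    exact ⟨hxy.2.1, hBx.tail hxy.2.2⟩

/-- An edge stays in its block or enters a child block, and that child is not `B`, since returning
to `B` would close a directed cycle. -/
theorem cl_sdiff_closed (hPs : IsDirectedTreePartition M.Edge Ps) (hB : B ∈ Ps) {s t : S}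
    (hs : s ∈ M.cl Ps B \ B) (hst : M.Edge s t) : t ∈ M.cl Ps B \ B := by
  obtain ⟨hs, hsB⟩ := hs
  obtain ⟨C, hBC, hsC⟩ := M.mem_cl.1 hs
  have hC := M.mem_of_reflTransGen_isParent hB hBC
  obtain ⟨D, hD, htD⟩ := hPs.exists_block t
  rcases eq_or_ne C D with rfl | hCD
  · refine ⟨M.mem_cl.2 ⟨C, hBC, htD⟩, fun htB => hsB ?_⟩
    rwa [hPs.block_unique hB htB hC htD]
  · have hpar : M.IsParent Ps C D := ⟨hC, hD, hCD, s, hsC, t, htD, hst⟩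
    refine ⟨M.mem_cl.2 ⟨D, hBC.tail hpar, htD⟩, fun htB => ?_⟩
    obtain rfl := hPs.block_unique hB htB hD htD
    exact M.not_isParent_of_reflTransGen hPs hB hBC hpar

/-- The block of `s` is a parent of the block of `t`. As in-degrees are at most one, it is the last
block before it on a path from `B`; so it lies in the closure, and `s` being outside `cl(B) \ B`
forces it to be `B`. -/
theorem mem_out_of_edge (hPs : IsDirectedTreePartition M.Edge Ps) (hB : B ∈ Ps) {s t : S}
    (hs : s ∉ M.cl Ps B \ B) (ht : t ∈ M.cl Ps B \ B) (hst : M.Edge s t) :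
    t ∈ M.out Ps B := by
  obtain ⟨ht, htB⟩ := ht
  obtain ⟨C, hBC, htC⟩ := M.mem_cl.1 ht
  have hC := M.mem_of_reflTransGen_isParent hB hBC
  have hsB {X : Set S} (hX : Relation.ReflTransGen (M.IsParent Ps) B X) (hsX : s ∈ X) : s ∈ B := by
    by_contra h
    exact hs ⟨M.mem_cl.2 ⟨X, hX, hsX⟩, h⟩
  obtain ⟨D, hD, hsD⟩ := hPs.exists_block s
  have hDC : D ≠ C := by
    rintro rfl
    rw [hPs.block_unique hB (hsB hBC hsD) hD hsD] at htB
    exact htB htC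
  have hpar : M.IsParent Ps D C := ⟨hD, hC, hDC, s, hsD, t, htC, hst⟩
  cases hBC with
  | refl => exact absurd htC htB
  | @tail C' _ hBC' hC' =>
    have hDC' : (⟨D, hD⟩ : Ps) = ⟨C', hC'.1⟩ :=
      hPs.isDirectedTree.indegree_le_one _ _ ⟨C, hC⟩ hpar.2.2 hC'.2.2
    obtain rfl := congrArg Subtype.val hDC'
    obtain rfl := hPs.block_unique hB (hsB hBC' hsD) hD hsD
    exact Set.mem_biUnion (show C ∈ {C | M.IsParent Ps B C} from hpar)
      ⟨htC, .inl ⟨B, hpar, s, hsD, hst⟩⟩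

theorem out_subset (hPs : IsDirectedTreePartition M.Edge Ps) : M.out Ps B ⊆ M.cl Ps B \ B := by
  intro t ht
  simp only [out, Set.mem_iUnion] at ht
  obtain ⟨C, hpar, ht⟩ := ht
  have hpar : M.IsParent Ps B C := hpar
  refine ⟨M.mem_cl.2 ⟨C, .single hpar, ht.1⟩, fun htB => ?_⟩
  exact hpar.2.2.1 (hPs.block_unique hpar.1 htB hpar.2.1 ht.1)

end MDP

theorem mainTheorem8 {S : Type u} {A : Type v} [Finite S] (M : MDP S A)
    (Goal : Set S) (hGoal : ∀ g ∈ Goal, M.IsTrap g)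
    (Ps : Set (Set S)) (hPs : IsDirectedTreePartition M.Edge Ps)
    (hBlocks : ∀ B ∈ Ps, B ⊆ Goal ∨ B ∩ Goal = ∅)
    (hInit : M.InitInRoot Ps)
    (B : Set S) (hB : B ∈ Ps) (S' S₁ S₂ S₁' : Set S)
    (hS₂ : S₂ = S' ∩ (M.cl Ps B \ B)) (hS₁ : S₁ = S' \ S₂) (hS₁' : S₁' = S₁ ∪ M.out Ps B)
    (v : Extremum) :
    -- for every `S'`, where states of `dom f = out(B)` count as reaching the goal only via `f`
    (∀ q : S₁', M.val v Goal S' q =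
      M.cutVal v (Goal \ M.out Ps B) S₁' (M.out Ps B) (M.val v Goal S₂)
        (fun s _ => M.val_le_one v Goal S₂ s) q) ∧
    -- if `S'` contains the goal states in `out(B)`, then these may also stay goal states
    (Goal ∩ M.out Ps B ⊆ S' → ∀ q : S₁', M.val v Goal S' q =
      M.cutVal v Goal S₁' (M.out Ps B) (M.val v Goal S₂)
        (fun s _ => M.val_le_one v Goal S₂ s) q) := by
  have hsub : S₂ ⊆ S' := hS₂ ▸ Set.inter_subset_left
  have hT : S₁' = S' \ S₂ ∪ M.out Ps B := by rw [hS₁', hS₁]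
  have hD : M.out Ps B ∩ S' ⊆ S₂ := fun s hs => hS₂ ▸ ⟨hs.2, M.out_subset hPs hs.1⟩
  have hclosed : ∀ s ∈ S₂, ∀ t ∈ S', M.Edge s t → t ∈ S₂ := by
    subst hS₂
    exact fun s hs t ht hst => ⟨ht, M.cl_sdiff_closed hPs hB hs.2 hst⟩
  have hinterface : ∀ s ∈ S' \ S₂, ∀ t ∈ S₂, M.Edge s t → t ∈ M.out Ps B := by
    subst hS₂
    exact fun s hs t ht hst => M.mem_out_of_edge hPs hB (fun h => hs.2 ⟨hs.1, h⟩) ht.2 hst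
  -- The two claims take `G = Goal \ out(B)`, which misses `out(B)`, and `G = Goal`.
  exact ⟨M.val_eq_cutVal v hsub hT hD hclosed hinterface Set.sdiff_subset le_rfl
      (fun s hs => absurd hs.2 hs.1.2) _,
    fun h => M.val_eq_cutVal v hsub hT hD hclosed hinterface le_rfl Set.sdiff_subset h _⟩
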